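/- **Setting.** Let $M$ be a compact Hausdorff space with a finite positive Borel measure $dx$ (for example a compact manifold with boundary), and write $(f,g)=\int_M f\,\overline{g}\,dx$ for the inner product of $L^2(M)$. Let $L_M$ be a linear operator $L$ with some domain $\mathrm{Dom}(L)\subset L^2(M)$ (for example a pseudo-differential operator on the interior of $M$ whose domain is given by boundary conditions on $\partial M$). Let $\mathcal I$ be a countable set and suppose that $\lambda_\xi\in\mathbb C$ and $u_\xi,v_\xi\in L^2(M)$ $(\xi\in\mathcal I)$ are such that * $u_\xi\in\mathrm{Dom}(L)$ and $Lu_\xi=\lambda_\xi u_\xi$; * $v_\xi\in\mathrm{Dom}(L^*)$ and $L^*v_\xi=\overline{\lambda_\xi}v_\xi$, where $L^*$ is the Hilbert space adjoint of $L$; * $(u_\xi,v_\xi)=1$, and $(u_\xi,v_\eta)=0$ for $\xi\ne\eta$; * every $f\in L^2(M)$ has a unique expansion $f=\sum_{\xi\in\mathcal I}a_\xi u_\xi$ converging in $L^2(M)$ (as a sum over the unordered set $\mathcal I$, i.e. along the net of finite partial sums; in particular $L$ is densely defined). Put $\mathrm{Dom}(L^0)=L^2(M)$, $\mathrm{Dom}(L^{k+1})=\{f\in\mathrm{Dom}(L):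 Lf\in\mathrm{Dom}(L^k)\}$, and let $C^\infty_L(M)=\bigcap_{k}\mathrm{Dom}(L^k)$ carry the topology given by the norms $\max_{j\le k}\|L^j\varphi\|_{L^2(M)}$, $k=0,1,2,\dots$. For $f\in C_L^\infty(M)$ let $\widehat f(\xi)=\int_M f\,\overline{v_\xi}\,dx$. A continuous linear operator $A:C_L^\infty(M)\to C_L^\infty(M)$ is an *$L$-Fourier multiplier with $L$-symbol* $\sigma_A:\mathcal I\to\mathbb C$ if $\widehat{Af}(\xi)=\sigma_A(\xi)\widehat f(\xi)$ for all $f\in C^\infty_L(M)$ and $\xi\in\mathcal I$. For $0<r<\infty$, the *Schatten class* $S_r(L^2(M))$ consists of the compact operators $T$ on $L^2(M)$ whose singular values (the positive eigenvalues of $(T^*T)^{1/2}$, counted with multiplicity) are $r$-summable; $A\in S_r(L^2(M))$ means that $A$ extends to a bounded operator on $L^2(M)$ that lies in $S_r(L^2(M))$. **Corollary 3.7.** Let $A:C_L^\infty(M)\to C_L^\infty(M)$ be an $L$-Fourier multiplier with $L$-symbol $\sigma_A$. (i) If $0<r\le 1$ and $\sum_{\xi\in\mathcal I}|\sigma_A(\xi)|^r<\infty$,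 then $A\in S_r(L^2(M))$. (ii) If $L_M$ is self-adjoint, i.e. $L^*=L$ with equality of domains, then for every $0<r<\infty$: $A\in S_r(L^2(M))$ if and only if $\sum_{\xi\in\mathcal I}|\sigma_A(\xi)|^r<\infty$. -/

import Mathlib

open MeasureTheory
open scoped InnerProductSpace ComplexConjugate

noncomputable section

namespace NonharmonicAnalysis

universe u v

section Abstract

variable {H : Type u} [NormedAddCommGroup H] [InnerProductSpace ℂ H]

/-! ### Test functions of an operator with a given domain -/

/-- The domain of the `k`-th power of an unbounded operator `L`: `Dom(L⁰)` is the whole space and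
`Dom(L^(k+1))` consists of all `f` in the domain of `L` such that `L f` lies in `Dom(L^k)`.
The boundary conditions are part of `L.domain`, so they are imposed on
`f, L f, …, L^(k-1) f`. -/
def powDomain (L : H →ₗ.[ℂ] H) : ℕ → Submodule ℂ H
  | 0 => ⊤
  | k + 1 => ((powDomain L k).comap L.toFun).map L.domain.subtype

lemma mem_powDomain_succ {L : H →ₗ.[ℂ] H} {k : ℕ} {f : H} :
    f ∈ powDomain L (k + 1) ↔ ∃ hf : f ∈ L.domain, L ⟨f, hf⟩ ∈ powDomain L k := by
  constructor
  · rintro ⟨g, hg, rfl⟩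
    exact ⟨g.2, hg⟩
  · rintro ⟨hf, h⟩
    exact ⟨⟨f, hf⟩, h, rfl⟩

/-- `Dom(L^∞)`, the intersection of the domains of all powers `L^k`. -/
def smoothDomain (L : H →ₗ.[ℂ] H) : Submodule ℂ H := ⨅ k : ℕ, powDomain L k

lemma smoothDomain_le_domain (L : H →ₗ.[ℂ] H) : smoothDomain L ≤ L.domain := by
  intro f hf
  exact (mem_powDomain_succ.1 ((Submodule.mem_iInf _).1 hf 1)).1

lemma map_mem_smoothDomain {L : H →ₗ.[ℂ] H} {f : H} (hf : f ∈ smoothDomain L) :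
    L ⟨f, smoothDomain_le_domain L hf⟩ ∈ smoothDomain L := by
  refine (Submodule.mem_iInf _).2 fun k => ?_
  exact (mem_powDomain_succ.1 ((Submodule.mem_iInf _).1 hf (k + 1))).2

/-- The space of test functions `C_L^∞ = Dom(L^∞)`. It is a type of its own, because it carries a
finer topology than the one induced by the norm of the ambient space. -/
def TestSpace (L : H →ₗ.[ℂ] H) : Type u := smoothDomain L

namespace TestSpace

variable (L : H →ₗ.[ℂ] H)

instance : AddCommGroup (TestSpace L) := inferInstanceAs (AddCommGroup (smoothDomain L))
instance : Module ℂ (TestSpace L) := inferInstanceAs (Module ℂ (smoothDomain L))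

/-- The inclusion of the test functions in the ambient Hilbert space. -/
def incl : TestSpace L →ₗ[ℂ] H := (smoothDomain L).subtype

/-- `L` as an operator from `C_L^∞` to itself. -/
def op : TestSpace L →ₗ[ℂ] TestSpace L where
  toFun f := ⟨L ⟨f.1, smoothDomain_le_domain L f.2⟩, map_mem_smoothDomain f.2⟩
  map_add' f g := Subtype.ext (L.toFun.map_add ⟨f.1, smoothDomain_le_domain L f.2⟩
    ⟨g.1, smoothDomain_le_domain L g.2⟩)
  map_smul' c f := Subtype.ext (L.toFun.map_smul c ⟨f.1, smoothDomain_le_domain L f.2⟩)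

/-- The norms `φ ↦ max_{j ≤ k} ‖L^j φ‖`, for `k = 0, 1, 2, …`. -/
def seminorms : SeminormFamily ℂ (TestSpace L) ℕ := fun k =>
  (Finset.range (k + 1)).sup fun j => (normSeminorm ℂ H).comp (incl L ∘ₗ op L ^ j)

/-- The topology on `C_L^∞` given by the norms `φ ↦ max_{j ≤ k} ‖L^j φ‖`. -/
instance : TopologicalSpace (TestSpace L) := (seminorms L).moduleFilterBasis.topology

end TestSpace

/-! ### Biorthogonal eigenfunction systems -/

/-- The spectral data of a model operator `L` (an operator together with its domain, which encodes
the boundary conditions): eigenvalues `lam ξ`, eigenfunctions `u ξ` of `L` and eigenfunctions `v ξ`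
of the Hilbert space adjoint `L†` for the conjugate eigenvalues, such that `u` and `v` are
biorthogonal and every vector has a unique convergent expansion in the system `u`. The countable
index set carries no order, so convergence of a series is that of the net of finite partial sums.
Since all `u ξ` lie in `L.domain`, the expansion property makes `L` densely defined, so that `L†`
is the genuine adjoint. -/
structure BiorthogonalEigensystem (L : H →ₗ.[ℂ] H) [CompleteSpace H] (I : Type v) where
  lam : I → ℂ
  u : I → H
  v : I → H
  u_mem : ∀ ξ, u ξ ∈ L.domain
  L_u : ∀ ξ, L ⟨u ξ, u_mem ξ⟩ = lam ξ • u ξ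
  v_mem : ∀ ξ, v ξ ∈ (LinearPMap.adjoint L).domain
  Lstar_v : ∀ ξ, LinearPMap.adjoint L ⟨v ξ, v_mem ξ⟩ = conj (lam ξ) • v ξ
  biorth_self : ∀ ξ, ⟪v ξ, u ξ⟫_ℂ = 1
  biorth_ne : ∀ ξ η, ξ ≠ η → ⟪v η, u ξ⟫_ℂ = 0
  basis : ∀ f : H, ∃! a : I → ℂ, HasSum (fun ξ => a ξ • u ξ) f

/-! ### Schatten classes -/

/-- The multiplicity of a number `s > 0` as a singular value of `T`, i.e. as an eigenvalue of
`|T| = (T* T)^(1/2)`: the dimension of the eigenspace of `T* T` for the eigenvalue `s²`.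
(It is zero if `s` is not a singular value; for compact `T` all these eigenspaces are
finite-dimensional.) -/
def singularMultiplicity [CompleteSpace H] (T : H →L[ℂ] H) (s : ℝ) : ℕ :=
  Module.finrank ℂ
    (Module.End.eigenspace ((ContinuousLinearMap.adjoint T ∘L T : H →L[ℂ] H) : H →ₗ[ℂ] H)
      ((s ^ 2 : ℝ) : ℂ))

/-- The Schatten class `S_r`: compact operators whose singular values, counted with multiplicity,
are `r`-summable. -/
def MemSchatten [CompleteSpace H] (r : ℝ) (T : H →L[ℂ] H) : Prop :=
  IsCompactOperator T ∧
    Summable fun s : {s : ℝ // 0 < s} => (singularMultiplicity T s : ℝ) * (s : ℝ) ^ r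

/-- An operator `A` on test functions belongs to the Schatten class `S_r` if it extends to a bounded
operator on the ambient Hilbert space which belongs to it. -/
def TestMemSchatten [CompleteSpace H] {L : H →ₗ.[ℂ] H} (r : ℝ)
    (A : TestSpace L →L[ℂ] TestSpace L) : Prop :=
  ∃ T : H →L[ℂ] H, (∀ f : TestSpace L, T (TestSpace.incl L f) = TestSpace.incl L (A f)) ∧
    MemSchatten r T

end Abstract

/-! ### Fourier transform and Fourier multipliers -/

section Fourier

variable {M : Type u} [MeasurableSpace M] {μ : Measure M} {I : Type v}
  {L : Lp ℂ 2 μ →ₗ.[ℂ] Lp ℂ 2 μ}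

/-- The `L`-Fourier transform `f̂(ξ) = ∫ f(x) conj(v_ξ(x)) dx` of a test function. -/
def fourierL (B : BiorthogonalEigensystem L I) (f : TestSpace L) (ξ : I) : ℂ :=
  ∫ x, (TestSpace.incl L f : Lp ℂ 2 μ) x * conj ((B.v ξ : Lp ℂ 2 μ) x) ∂μ

lemma fourierL_eq_inner (B : BiorthogonalEigensystem L I) (f : TestSpace L) (ξ : I) :
    fourierL B f ξ = ⟪B.v ξ, TestSpace.incl L f⟫_ℂ := by
  rw [L2.inner_def]
  simp [fourierL, RCLike.inner_apply]

/-- `A` is an `L`-Fourier multiplier with `L`-symbol `σ`. -/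
def IsFourierMultiplier (B : BiorthogonalEigensystem L I) (A : TestSpace L →L[ℂ] TestSpace L)
    (σ : I → ℂ) : Prop :=
  ∀ (f : TestSpace L) (ξ : I), fourierL B (A f) ξ = σ ξ * fourierL B f ξ

end Fourier

end NonharmonicAnalysis

end

/-! ### Comparison of counting functions and bounded multipliers. -/

namespace NonharmonicAnalysis

/-! Both parts come from one equivalence, `testMemSchatten_iff`. Unordered convergence makes the `u
ξ` an unconditional basis, so by uniform boundedness finite multipliers obey `‖∑ m ξ • coordProj ξ‖
≤ C sup |m|` (`exists_norm_sum_coordProj_le`). This replaces orthogonality at the cost of the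
constant `C`. A dimension count then compares singular values with symbol values: for every `t > 0`,
at most as many singular values are `≥ t` as there are `ξ` with `2C|σ ξ| ≥ t`
(`memSchatten_of_hasSum`), and the same with the roles exchanged (`summable_of_memSchatten`). If
either count failed, some nonzero vector would satisfy incompatible upper and lower bounds for `T`.
Hall's theorem turns the counts into a termwise comparison, so `r`-summability transfers both ways.
-/

/-- If every element of `α` is compared with at least as many elements of `β` in the sense of
counting functions, then `r`-summability passes from `b` to `a`. -/
lemma summable_rpow_of_card_le {α β : Type*} {a : α → ℝ} {b : β → ℝ} {C r : ℝ}
    (ha : ∀ i, 0 ≤ a i) (hb : ∀ j, 0 ≤ b j) (hC : 0 < C) (hr : 0 < r)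
    (hsum : Summable fun j => b j ^ r)
    (h : ∀ (A : Finset α) (B : Finset β) (t : ℝ), 0 < t → (∀ i ∈ A, t ≤ a i) →
      (∀ j, t ≤ C * b j → j ∈ B) → A.card ≤ B.card) :
    Summable fun i => a i ^ r := by
  classical
  have hfin : ∀ t : ℝ, 0 < t → {j | t ≤ C * b j}.Finite := by
    intro t ht
    have h1 : ∀ᶠ j in Filter.cofinite, b j ^ r < (t / C) ^ r :=
      hsum.tendsto_cofinite_zero.eventually_lt_const (by positivity)
    refine (Filter.eventually_cofinite.1 h1).subset fun j hj => ?_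
    simp only [Set.mem_ofPred_eq, not_lt] at hj ⊢
    exact Real.rpow_le_rpow (by positivity) ((div_le_iff₀' hC).2 hj) hr.le
  have hbr : ∀ j, 0 ≤ b j ^ r := fun j => Real.rpow_nonneg (hb j) r
  refine summable_of_sum_le (c := C ^ r * ∑' j, b j ^ r)
    (fun i => Real.rpow_nonneg (ha i) r) fun S => ?_
  let S' := S.filter fun i => 0 < a i
  let t : S' → Finset β := fun i => (hfin (a i) (Finset.mem_filter.1 i.2).2).toFinset
  have hmem : ∀ i j, j ∈ t i ↔ a i ≤ C * b j := fun i j => by simp [t]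
  -- Hall's marriage theorem. The sets `t i` grow as `a i` decreases, so Hall's condition for `A` is
  -- the counting hypothesis at the threshold `min a`.
  obtain ⟨φ, hφ, hφt⟩ := (Finset.all_card_le_biUnion_card_iff_exists_injective t).1 fun A => by
    rcases A.eq_empty_or_nonempty with rfl | hA
    · simp
    obtain ⟨i₀, hi₀, hmin⟩ := A.exists_min_image (fun i => a i) hA
    have := h (A.map (Function.Embedding.subtype _)) (A.biUnion t) (a i₀)
      (Finset.mem_filter.1 i₀.2).2 (by
        intro i hi
        obtain ⟨i', hi', rfl⟩ := Finset.mem_map.1 hi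
        exact hmin i' hi') (fun j hj => Finset.mem_biUnion.2 ⟨i₀, hi₀, (hmem _ _).2 hj⟩)
    simpa using this
  calc ∑ i ∈ S, a i ^ r = ∑ i ∈ S', a i ^ r := by
        refine (Finset.sum_filter_of_ne fun i _ hi => ?_).symm
        refine (ha i).lt_of_ne fun h0 => hi ?_
        rw [← h0, Real.zero_rpow hr.ne']
    _ = ∑ i : S', a i ^ r := (Finset.sum_coe_sort S' _).symm
    _ ≤ ∑ i : S', C ^ r * b (φ i) ^ r := by
        refine Finset.sum_le_sum fun i _ => ?_
        rw [← Real.mul_rpow hC.le (hb _)]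
        exact Real.rpow_le_rpow (ha _) ((hmem _ _).1 (hφt i)) hr.le
    _ = C ^ r * ∑ j ∈ Finset.univ.map ⟨φ, hφ⟩, b j ^ r := by
        rw [← Finset.mul_sum, Finset.sum_map]; rfl
    _ ≤ _ := by
        gcongr
        exact hsum.sum_le_tsum _ fun j _ => hbr j

/-- The positive and the negative terms each form a subset sum, whence the factor 2. -/
lemma sum_abs_le_two_mul {ι : Type*} {F : Finset ι} {a : ι → ℝ} {K : ℝ}
    (h : ∀ G ⊆ F, |∑ i ∈ G, a i| ≤ K) : ∑ i ∈ F, |a i| ≤ 2 * K := by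
  classical
  rw [← Finset.sum_filter_add_sum_filter_not F fun i => 0 ≤ a i]
  have h1 : ∑ i ∈ F with 0 ≤ a i, |a i| = ∑ i ∈ F with 0 ≤ a i, a i :=
    Finset.sum_congr rfl fun i hi => abs_of_nonneg (Finset.mem_filter.1 hi).2
  have h2 : ∑ i ∈ F with ¬ 0 ≤ a i, |a i| = - ∑ i ∈ F with ¬ 0 ≤ a i, a i := by
    rw [← Finset.sum_neg_distrib]
    exact Finset.sum_congr rfl fun i hi => abs_of_neg (not_le.1 (Finset.mem_filter.1 hi).2)
  have h3 := h _ (Finset.filter_subset (fun i => 0 ≤ a i) F)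
  have h4 := h _ (Finset.filter_subset (fun i => ¬ 0 ≤ a i) F)
  rw [h1, h2]
  linarith [le_abs_self (∑ i ∈ F with 0 ≤ a i, a i), neg_le_abs (∑ i ∈ F with ¬ 0 ≤ a i, a i)]

section Abstract

variable {H : Type*} [NormedAddCommGroup H] [InnerProductSpace ℂ H]

lemma sum_norm_inner_le {ι : Type*} {F : Finset ι} {x : ι → H} {K : ℝ}
    (h : ∀ G ⊆ F, ‖∑ i ∈ G, x i‖ ≤ K) (y : H) : ∑ i ∈ F, ‖⟪y, x i⟫_ℂ‖ ≤ 4 * (K * ‖y‖) := by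
  have hG : ∀ G ⊆ F, ‖∑ i ∈ G, ⟪y, x i⟫_ℂ‖ ≤ K * ‖y‖ := fun G hG => by
    rw [← inner_sum, mul_comm]
    exact (norm_inner_le_norm _ _).trans (by gcongr; exact h G hG)
  have hre : ∑ i ∈ F, |(⟪y, x i⟫_ℂ).re| ≤ 2 * (K * ‖y‖) := sum_abs_le_two_mul fun G hGF => by
    rw [← Complex.re_sum]
    exact (Complex.abs_re_le_norm _).trans (hG G hGF)
  have him : ∑ i ∈ F, |(⟪y, x i⟫_ℂ).im| ≤ 2 * (K * ‖y‖) := sum_abs_le_two_mul fun G hGF => by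
    rw [← Complex.im_sum]
    exact (Complex.abs_im_le_norm _).trans (hG G hGF)
  calc ∑ i ∈ F, ‖⟪y, x i⟫_ℂ‖ ≤ ∑ i ∈ F, (|(⟪y, x i⟫_ℂ).re| + |(⟪y, x i⟫_ℂ).im|) :=
        Finset.sum_le_sum fun i _ => Complex.norm_le_abs_re_add_abs_im _
    _ ≤ _ := by rw [Finset.sum_add_distrib]; linarith

/-- A family with bounded finite partial sums admits all bounded multipliers. -/
lemma norm_sum_smul_le {ι : Type*} {F : Finset ι} {x : ι → H} {m : ι → ℂ} {K N : ℝ}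
    (h : ∀ G ⊆ F, ‖∑ i ∈ G, x i‖ ≤ K) (hN : 0 ≤ N) (hm : ∀ i ∈ F, ‖m i‖ ≤ N) :
    ‖∑ i ∈ F, m i • x i‖ ≤ 4 * K * N := by
  set y := ∑ i ∈ F, m i • x i with hy
  have hK : 0 ≤ K := (norm_nonneg _).trans (h ∅ (Finset.empty_subset _))
  -- Duality: testing `y` against itself moves the multipliers onto absolutely summed scalars.
  have h1 : ‖y‖ * ‖y‖ ≤ 4 * K * N * ‖y‖ := by
    calc ‖y‖ * ‖y‖ = ‖⟪y, y⟫_ℂ‖ := by rw [inner_self_eq_norm_sq_to_K]; simp [sq]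
      _ = ‖∑ i ∈ F, m i * ⟪y, x i⟫_ℂ‖ := by
        conv_lhs => rw [hy, inner_sum, ← hy]
        simp only [inner_smul_right]
      _ ≤ ∑ i ∈ F, N * ‖⟪y, x i⟫_ℂ‖ := by
        refine norm_sum_le_of_le _ fun i hi => ?_
        rw [norm_mul]
        gcongr
        exact hm i hi
      _ ≤ N * (4 * (K * ‖y‖)) := by
        rw [← Finset.mul_sum]
        gcongr
        exact sum_norm_inner_le h y
      _ = _ := by ring
  rcases (norm_nonneg y).eq_or_lt with h0 | h0
  · rw [← h0]; positivity
  · exact le_of_mul_le_mul_right h1 h0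

lemma exists_norm_sum_le_of_summable {ι E : Type*} [NormedAddCommGroup E] [CompleteSpace E]
    {x : ι → E} (hx : Summable x) :
    ∃ K, ∀ F : Finset ι, ‖∑ i ∈ F, x i‖ ≤ K := by
  classical
  obtain ⟨s, hs⟩ := summable_iff_vanishing_norm.1 hx 1 one_pos
  refine ⟨∑ i ∈ s, ‖x i‖ + 1, fun F => ?_⟩
  rw [← Finset.sum_inter_add_sum_sdiff F s]
  refine (norm_add_le _ _).trans (add_le_add ?_ (hs _ Finset.sdiff_disjoint).le)
  exact (norm_sum_le _ _).trans
    (Finset.sum_le_sum_of_subset_of_nonneg Finset.inter_subset_right fun _ _ _ => norm_nonneg _)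

namespace BiorthogonalEigensystem

variable [CompleteSpace H] {L : H →ₗ.[ℂ] H} {I : Type*} (B : BiorthogonalEigensystem L I)

lemma inner_v_u [DecidableEq I] (η ξ : I) : ⟪B.v η, B.u ξ⟫_ℂ = if ξ = η then 1 else 0 := by
  split_ifs with h
  · rw [h, B.biorth_self]
  · exact B.biorth_ne _ _ h

/-- The coefficients of an expansion are given by the biorthogonal system. -/
lemma coeff_eq {a : I → ℂ} {f : H} (h : HasSum (fun ξ => a ξ • B.u ξ) f) (η : I) :
    a η = ⟪B.v η, f⟫_ℂ := by
  classical
  have h1 := h.mapL (innerSL ℂ (B.v η))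
  simp only [innerSL_apply_apply, inner_smul_right, B.inner_v_u] at h1
  refine HasSum.unique ?_ h1
  convert hasSum_single η fun ξ hξ => ?_ using 1
  · simp
  · simp [hξ]

lemma hasSum_expansion (f : H) : HasSum (fun ξ => ⟪B.v ξ, f⟫_ℂ • B.u ξ) f := by
  obtain ⟨a, ha, -⟩ := B.basis f
  convert ha using 3 with ξ
  exact (B.coeff_eq ha ξ).symm

/-- The rank one operator `f ↦ (f, v ξ) u ξ`. -/
noncomputable def coordProj (ξ : I) : H →L[ℂ] H := (innerSL ℂ (B.v ξ)).smulRight (B.u ξ)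

@[simp] lemma coordProj_apply (ξ : I) (f : H) : B.coordProj ξ f = ⟪B.v ξ, f⟫_ℂ • B.u ξ := rfl

lemma exists_norm_sum_coordProj_le :
    ∃ C : ℝ, 0 < C ∧ ∀ (F : Finset I) (m : I → ℂ) (N : ℝ), 0 ≤ N → (∀ ξ ∈ F, ‖m ξ‖ ≤ N) →
      ‖∑ ξ ∈ F, m ξ • B.coordProj ξ‖ ≤ C * N := by
  -- Partial sums are bounded at each `f` because the expansion of `f` converges unconditionally.
  obtain ⟨K, hK⟩ := banach_steinhaus (g := fun F : Finset I => ∑ ξ ∈ F, B.coordProj ξ) fun f => by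
    obtain ⟨K, hK⟩ := exists_norm_sum_le_of_summable (B.hasSum_expansion f).summable
    exact ⟨K, fun F => by simpa using hK F⟩
  have hK0 : 0 ≤ K := (norm_nonneg _).trans (hK ∅)
  refine ⟨4 * K + 1, by positivity, fun F m N hN hm => ?_⟩
  refine ContinuousLinearMap.opNorm_le_bound _ (by positivity) fun f => ?_
  have := norm_sum_smul_le (F := F) (x := fun ξ => B.coordProj ξ f) (K := K * ‖f‖)
    (fun G _ => by
      have := (∑ ξ ∈ G, B.coordProj ξ).le_of_opNorm_le (hK G) f
      simpa using this) hN hm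
  simp only [sum_apply, smul_apply]
  refine this.trans ?_
  nlinarith [mul_nonneg hN (norm_nonneg f)]

end BiorthogonalEigensystem

end Abstract

end NonharmonicAnalysis

namespace NonharmonicAnalysis

/-! ### Singular vectors of compact operators. -/

section Singular

variable {H : Type*} [NormedAddCommGroup H] [InnerProductSpace ℂ H]

lemma norm_sq_sum_of_inner_eq_zero {ι : Type*} {S : Finset ι} {x : ι → H}
    (h : ∀ i j, i ≠ j → ⟪x i, x j⟫_ℂ = 0) : ‖∑ i ∈ S, x i‖ ^ 2 = ∑ i ∈ S, ‖x i‖ ^ 2 := by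
  classical
  induction S using Finset.induction_on with
  | empty => simp
  | insert a S ha ih =>
    rw [Finset.sum_insert ha, Finset.sum_insert ha, ← ih, sq, sq, sq]
    refine norm_add_sq_eq_norm_sq_add_norm_sq_of_inner_eq_zero _ _ (𝕜 := ℂ) ?_
    rw [inner_sum]
    exact Finset.sum_eq_zero fun i hi => h _ _ fun hai => ha (hai ▸ hi)

/-- A nontrivial linear combination of a family that is annihilated by fewer functionals. -/
lemma exists_combination_orthogonal {α β : Type*} {A : Finset α} {B : Finset β}
    (hAB : B.card < A.card) (x : α → H) (y : β → H) :
    ∃ c : A → ℂ, c ≠ 0 ∧ ∀ j ∈ B, ⟪y j, ∑ i, c i • x i⟫_ℂ = 0 := by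
  let Φ : (A → ℂ) →ₗ[ℂ] (B → ℂ) := LinearMap.pi fun j =>
    (innerSL ℂ (y j)).toLinearMap ∘ₗ Fintype.linearCombination ℂ fun i : A => x i
  obtain ⟨c, hc, hc0⟩ := (Submodule.ne_bot_iff _).1
    (Φ.ker_ne_bot_of_finrank_lt (by simpa using hAB))
  refine ⟨c, hc0, fun j hj => ?_⟩
  have := congrFun (LinearMap.mem_ker.1 hc) ⟨j, hj⟩
  simpa [Φ, Fintype.linearCombination_apply, inner_sum, inner_smul_right] using this

variable [CompleteSpace H] (T : H →L[ℂ] H)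

/-- The operator `T* T`. -/
noncomputable abbrev gram : H →L[ℂ] H := ContinuousLinearMap.adjoint T ∘L T

lemma inner_gram_right (x y : H) : ⟪x, gram T y⟫_ℂ = ⟪T x, T y⟫_ℂ := by
  simp [gram, ContinuousLinearMap.adjoint_inner_right]

lemma gram_isSymmetric : (gram T : H →ₗ[ℂ] H).IsSymmetric := fun x y => by
  simp [gram, ContinuousLinearMap.adjoint_inner_right, ContinuousLinearMap.adjoint_inner_left]

variable {T}

lemma norm_sq_map_sum_of_gram {ι : Type*} {S : Finset ι} {x : ι → H} {c : ι → ℝ}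
    (h : ∀ i j, i ≠ j → ⟪x i, x j⟫_ℂ = 0) (hc : ∀ i, gram T (x i) = (c i : ℂ) • x i) :
    ‖T (∑ i ∈ S, x i)‖ ^ 2 = ∑ i ∈ S, c i * ‖x i‖ ^ 2 := by
  rw [map_sum, norm_sq_sum_of_inner_eq_zero]
  · refine Finset.sum_congr rfl fun i _ => ?_
    have h1 : ⟪T (x i), T (x i)⟫_ℂ = (c i : ℂ) * ⟪x i, x i⟫_ℂ := by
      rw [← inner_gram_right, hc, inner_smul_right]
    rw [inner_self_eq_norm_sq_to_K, inner_self_eq_norm_sq_to_K] at h1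
    simp only [Complex.coe_algebraMap] at h1
    exact_mod_cast h1
  · intro i j hij
    rw [← inner_gram_right, hc, inner_smul_right, h i j hij, mul_zero]

/-- If `T` is compact and `f` is orthogonal to all singular vectors of `T` for singular values at
least `τ`, then `‖T f‖ ≤ τ ‖f‖`. -/
lemma norm_map_le_of_orthogonal (hT : IsCompactOperator T) {τ : ℝ} (hτ : 0 < τ) {f : H}
    (hf : ∀ s : ℝ, τ ≤ s → ∀ w : H, gram T w = ((s ^ 2 : ℝ) : ℂ) • w → ⟪w, f⟫_ℂ = 0) :
    ‖T f‖ ≤ τ * ‖f‖ := by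
  have hcomp : IsCompactOperator (gram T) := hT.clm_comp (ContinuousLinearMap.adjoint T)
  have hsymm := gram_isSymmetric T
  have hbot := ContinuousLinearMap.orthogonalComplement_iSup_eigenspaces_eq_bot hcomp hsymm
  have : ∀ μ, CompleteSpace (Module.End.eigenspace (gram T : H →ₗ[ℂ] H) μ) := fun μ => by
    refine IsClosed.completeSpace_coe (hs := ?_)
    have : (Module.End.eigenspace (gram T : H →ₗ[ℂ] H) μ : Set H) = {x | gram T x = μ • x} := by
      ext x; simp
    rw [this]
    exact isClosed_eq (gram T).continuous (continuous_const_smul μ)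
  have hsum := IsHilbertSum.mkInternal _ hsymm.orthogonalFamily_eigenspaces
    ((Submodule.topologicalClosure_eq_top_iff.2 hbot).ge)
  set w := hsum.linearIsometryEquiv f with hw
  have hwf : HasSum (fun μ => (w μ : H)) f := by
    have h := hsum.hasSum_linearIsometryEquiv_symm w
    rwa [hw, LinearIsometryEquiv.symm_apply_apply] at h
  have horth : ∀ μ ν, μ ≠ ν → ⟪(w μ : H), (w ν : H)⟫_ℂ = 0 := fun μ ν hμν =>
    hsymm.orthogonalFamily_eigenspaces hμν (w μ) (w ν)
  have hmem : ∀ μ, gram T (w μ : H) = μ • (w μ : H) := fun μ =>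
    Module.End.mem_eigenspace_iff.1 (w μ).2
  -- Eigenvalues with a nonzero component are real by symmetry; for a zero component any scalar
  -- serves.
  have hre : ∀ μ, gram T (w μ : H) = ((μ.re : ℝ) : ℂ) • (w μ : H) := fun μ => by
    by_cases h0 : (w μ : H) = 0
    · simp [h0]
    · have h1 := hsymm.conj_eigenvalue_eq_self
        (Module.End.hasEigenvalue_of_hasEigenvector ⟨(w μ).2, h0⟩)
      rw [Complex.conj_eq_iff_re.1 h1, hmem]
  have hself : ∀ μ, ⟪(w μ : H), f⟫_ℂ = ((‖(w μ : H)‖ : ℂ)) ^ 2 := fun μ => by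
    have h1 := hwf.mapL (innerSL ℂ (w μ : H))
    simp only [innerSL_apply_apply] at h1
    have h2 := hasSum_single (f := fun ν => ⟪(w μ : H), (w ν : H)⟫_ℂ) μ
      fun ν hν => horth μ ν hν.symm
    rw [h1.unique h2, inner_self_eq_norm_sq_to_K]
    simp
  -- For `μ.re ≥ τ²` the component `w μ` is a singular vector orthogonal to `f`, hence zero by
  -- `hself`.
  have hle : ∀ μ : ℂ, μ.re * ‖(w μ : H)‖ ^ 2 ≤ τ ^ 2 * ‖(w μ : H)‖ ^ 2 := fun μ => by
    rcases lt_or_ge μ.re (τ ^ 2) with h | h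
    · gcongr
    · have h1 := hf (Real.sqrt μ.re) (Real.le_sqrt_of_sq_le h) (w μ : H) (by
        rw [Real.sq_sqrt ((sq_nonneg τ).trans h), hre])
      rw [hself] at h1
      have h2 : ‖(w μ : H)‖ ^ 2 = 0 := by exact_mod_cast h1
      rw [h2, mul_zero, mul_zero]
  have hfin : ∀ S : Finset ℂ, ‖T (∑ μ ∈ S, (w μ : H))‖ ≤ τ * ‖∑ μ ∈ S, (w μ : H)‖ := fun S => by
    refine le_of_sq_le_sq ?_ (by positivity)
    rw [norm_sq_map_sum_of_gram horth hre, mul_pow, norm_sq_sum_of_inner_eq_zero horth,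
      Finset.mul_sum]
    exact Finset.sum_le_sum fun μ _ => hle μ
  exact le_of_tendsto_of_tendsto' ((T.continuous.tendsto f).comp hwf).norm
    (Filter.Tendsto.const_mul τ hwf.norm) hfin

variable (T)

/-- The singular values of `T`, repeated according to multiplicity. -/
abbrev SingularIndex : Type :=
  Σ s : {s : ℝ // 0 < s}, Fin (singularMultiplicity T s)

/-- Compactness makes each eigenspace for `s² > 0` finite-dimensional, so `finrank` is its true
dimension and an orthonormal basis is indexed by the multiplicity. -/
lemma exists_singular_vectors (hT : IsCompactOperator T) :
    ∃ e : SingularIndex T → H, Orthonormal ℂ e ∧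
      (∀ j, gram T (e j) = (((j.1 : ℝ) ^ 2 : ℝ) : ℂ) • e j) ∧
      ∀ (s : {s : ℝ // 0 < s}) (f : H), (∀ k, ⟪e ⟨s, k⟩, f⟫_ℂ = 0) →
        ∀ w, gram T w = (((s : ℝ) ^ 2 : ℝ) : ℂ) • w → ⟪w, f⟫_ℂ = 0 := by
  have hcomp : IsCompactOperator (gram T) := hT.clm_comp (ContinuousLinearMap.adjoint T)
  have : ∀ s : {s : ℝ // 0 < s}, FiniteDimensional ℂ
      (Module.End.eigenspace (gram T : H →ₗ[ℂ] H) (((s : ℝ) ^ 2 : ℝ) : ℂ)) := fun s =>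
    ContinuousLinearMap.finite_dimensional_eigenspace hcomp _ (by
      exact_mod_cast (pow_pos s.2 2).ne')
  let b : ∀ s : {s : ℝ // 0 < s}, OrthonormalBasis (Fin (singularMultiplicity T s)) ℂ
      (Module.End.eigenspace (gram T : H →ₗ[ℂ] H) (((s : ℝ) ^ 2 : ℝ) : ℂ)) :=
    fun s => stdOrthonormalBasis ℂ _
  have hinj : Function.Injective fun s : {s : ℝ // 0 < s} => (((s : ℝ) ^ 2 : ℝ) : ℂ) := by
    intro s t hst
    have : (s : ℝ) ^ 2 = (t : ℝ) ^ 2 := Complex.ofReal_injective hst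
    exact Subtype.ext ((pow_left_inj₀ s.2.le t.2.le two_ne_zero).1 this)
  have hfam := (gram_isSymmetric T).orthogonalFamily_eigenspaces.comp hinj
  refine ⟨fun j => (b j.1 j.2 : H), hfam.orthonormal_sigma_orthonormal fun s => (b s).orthonormal,
    fun j => Module.End.mem_eigenspace_iff.1 (b j.1 j.2).2, fun s f hf w hw => ?_⟩
  have h1 := congrArg (Subtype.val) ((b s).sum_repr ⟨w, Module.End.mem_eigenspace_iff.2 hw⟩)
  simp only [AddSubmonoidClass.coe_finsetSum, Submodule.coe_smul] at h1
  rw [← h1, sum_inner]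
  refine Finset.sum_eq_zero fun k _ => ?_
  rw [inner_smul_left, hf k, mul_zero]

variable {T}

lemma memSchatten_iff {r : ℝ} :
    MemSchatten r T ↔ IsCompactOperator T ∧
      Summable fun j : SingularIndex T => (j.1 : ℝ) ^ r := by
  refine and_congr_right fun _ => ?_
  rw [summable_sigma_of_nonneg fun j => Real.rpow_nonneg j.1.2.le r]
  have : ∀ s : {s : ℝ // 0 < s}, Summable fun _ : Fin (singularMultiplicity T s) => (s : ℝ) ^ r :=
    fun s => (hasSum_fintype _).summable
  simp [this, tsum_fintype]

end Singular

end NonharmonicAnalysis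

namespace NonharmonicAnalysis

/-! ### Schatten membership of multipliers. -/

section Multiplier

variable {H : Type*} [NormedAddCommGroup H] [InnerProductSpace ℂ H]

lemma norm_sq_sum_smul_orthonormal {ι : Type*} [Fintype ι] {e : ι → H} (he : Orthonormal ℂ e)
    (c : ι → ℂ) : ‖∑ i, c i • e i‖ ^ 2 = ∑ i, ‖c i‖ ^ 2 := by
  rw [norm_sq_sum_of_inner_eq_zero]
  · simp [norm_smul, he.1]
  · intro i j hij
    simp [he.2 hij]

namespace BiorthogonalEigensystem

variable [CompleteSpace H] {L : H →ₗ.[ℂ] H} {I : Type*} (B : BiorthogonalEigensystem L I)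

lemma isCompactOperator_coordProj (ξ : I) : IsCompactOperator (B.coordProj ξ) := by
  have h : IsCompactOperator (ContinuousLinearMap.toSpanSingleton ℂ (B.u ξ)) :=
    isCompactOperator_of_locallyCompactSpace_rng _
  exact h.comp_clm (innerSL ℂ (B.v ξ))

/-- A multiplier with `r`-summable symbol defines an operator, convergent in operator norm. -/
lemma summable_smul_coordProj {σ : I → ℂ} {r : ℝ} (hr : 0 < r)
    (hσ : Summable fun ξ => ‖σ ξ‖ ^ r) : Summable fun ξ => σ ξ • B.coordProj ξ := by
  obtain ⟨C, hC, hB⟩ := B.exists_norm_sum_coordProj_le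
  refine summable_iff_vanishing_norm.2 fun ε hε => ?_
  -- Only `σ → 0` matters: the multiplier bound controls tails by the supremum of `|σ|`.
  have h1 : ∀ᶠ ξ in Filter.cofinite, ‖σ ξ‖ ^ r < (ε / (2 * C)) ^ r :=
    hσ.tendsto_cofinite_zero.eventually_lt_const (by positivity)
  have hfin := Filter.eventually_cofinite.1 h1
  refine ⟨hfin.toFinset, fun F hF => ?_⟩
  refine (hB F σ (ε / (2 * C)) (by positivity) fun ξ hξ => ?_).trans_lt ?_
  · have h2 := Finset.disjoint_left.1 hF hξ
    simp only [Set.Finite.mem_toFinset, Set.mem_ofPred_eq, not_not] at h2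
    exact ((Real.rpow_lt_rpow_iff (norm_nonneg _) (by positivity) hr).1 h2).le
  · rw [mul_div_assoc', mul_comm 2 C, mul_div_mul_left _ _ hC.ne']
    exact half_lt_self hε

/-- With too many singular values `≥ t`, some nonzero `g` in their span is annihilated by every `v
ξ` with `2C|σ ξ| ≥ t`. Then `‖T g‖ ≥ t‖g‖`, while the remaining multiplier gives `‖T g‖ ≤ (t/2)‖g‖`.
-/
lemma memSchatten_of_hasSum {σ : I → ℂ} {r : ℝ} (hr : 0 < r) (hσ : Summable fun ξ => ‖σ ξ‖ ^ r)
    {T : H →L[ℂ] H} (hT : HasSum (fun ξ => σ ξ • B.coordProj ξ) T) : MemSchatten r T := by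
  obtain ⟨C, hC, hB⟩ := B.exists_norm_sum_coordProj_le
  have hcomp : IsCompactOperator T := isCompactOperator_of_tendsto hT <| .of_forall fun F =>
    Submodule.sum_mem (compactOperator (RingHom.id ℂ) H H) fun ξ _ =>
      Submodule.smul_mem _ (σ ξ) (B.isCompactOperator_coordProj ξ)
  refine memSchatten_iff.2 ⟨hcomp, ?_⟩
  obtain ⟨e, he, hge, -⟩ := exists_singular_vectors T hcomp
  refine summable_rpow_of_card_le (C := 2 * C) (fun j => j.1.2.le) (fun ξ => norm_nonneg (σ ξ))
    (by positivity) hr hσ fun A S t ht hA hS => ?_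
  by_contra! hlt
  obtain ⟨c, hc, hcS⟩ := exists_combination_orthogonal hlt e B.v
  have heA : Orthonormal ℂ fun i : A => e i := he.comp _ Subtype.val_injective
  set g : H := ∑ i, c i • e i with hg
  have hg2 : ‖g‖ ^ 2 = ∑ i, ‖c i‖ ^ 2 := norm_sq_sum_smul_orthonormal heA c
  have hgpos : 0 < ‖g‖ := by
    obtain ⟨i, hi⟩ := Function.ne_iff.1 hc
    have : 0 < ‖g‖ ^ 2 := by
      rw [hg2]
      exact Finset.sum_pos' (fun i _ => by positivity)
        ⟨i, Finset.mem_univ i, pow_pos (norm_pos_iff.2 hi) 2⟩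
    exact (norm_nonneg g).lt_of_ne' (pow_ne_zero_iff two_ne_zero |>.1 this.ne')
  have hlow : t * ‖g‖ ≤ ‖T g‖ := by
    refine le_of_sq_le_sq ?_ (norm_nonneg _)
    rw [hg, norm_sq_map_sum_of_gram (c := fun i : A => ((i : SingularIndex T).1 : ℝ) ^ 2),
      ← hg, mul_pow, hg2, Finset.mul_sum]
    · refine Finset.sum_le_sum fun i _ => ?_
      rw [norm_smul, he.1, mul_one]
      gcongr
      exact hA i i.2
    · intro i j hij
      simp [heA.2 hij]
    · intro i
      rw [map_smul, hge, smul_comm]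
  have hTg : HasSum (fun ξ => (σ ξ * ⟪B.v ξ, g⟫_ℂ) • B.u ξ) (T g) := by
    have := hT.mapL (ContinuousLinearMap.apply ℂ H g)
    simpa [mul_smul] using this
  have hup : ‖T g‖ ≤ t / 2 * ‖g‖ := by
    classical
    refine le_of_tendsto' (hTg.norm) fun G => ?_
    have h1 := hB (G \ S) σ (t / (2 * C)) (by positivity) fun ξ hξ => by
      by_contra! h2
      refine (Finset.mem_sdiff.1 hξ).2 (hS ξ ?_)
      exact ((div_lt_iff₀' (by positivity)).1 h2).le
    have h2 := ContinuousLinearMap.le_of_opNorm_le _ h1 g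
    have h3 : C * (t / (2 * C)) = t / 2 := by field_simp
    rw [h3] at h2
    suffices h4 : ∑ ξ ∈ G, (σ ξ * ⟪B.v ξ, g⟫_ℂ) • B.u ξ =
        (∑ ξ ∈ G \ S, σ ξ • B.coordProj ξ) g from h4 ▸ h2
    rw [← Finset.sum_inter_add_sum_sdiff G S, Finset.sum_eq_zero, zero_add]
    · simp [mul_smul]
    · intro ξ hξ
      rw [hcS ξ (Finset.mem_inter.1 hξ).2, mul_zero, zero_smul]
  nlinarith

/-- With too many `|σ ξ| ≥ t`, some nonzero `f` in the span of these `u ξ` is orthogonal to all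
singular vectors with `s ≥ t/(2C)`, so `‖T f‖ ≤ t/(2C)‖f‖`. But the multiplier `σ⁻¹` inverts `T`
there with norm at most `C/t`. -/
lemma summable_of_memSchatten {σ : I → ℂ} {r : ℝ} (hr : 0 < r) {T : H →L[ℂ] H}
    (hT : MemSchatten r T) (hTu : ∀ ξ, T (B.u ξ) = σ ξ • B.u ξ) :
    Summable fun ξ => ‖σ ξ‖ ^ r := by
  classical
  obtain ⟨C, hC, hB⟩ := B.exists_norm_sum_coordProj_le
  obtain ⟨hcomp, hsum⟩ := memSchatten_iff.1 hT
  obtain ⟨e, -, -, hspan⟩ := exists_singular_vectors T hcomp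
  refine summable_rpow_of_card_le (C := 2 * C) (fun ξ => norm_nonneg (σ ξ)) (fun j => j.1.2.le)
    (by positivity) hr hsum fun A S t ht hA hS => ?_
  by_contra! hlt
  obtain ⟨c, hc, hcS⟩ := exists_combination_orthogonal hlt B.u e
  set f : H := ∑ ξ, c ξ • B.u ξ with hf
  have hcoef : ∀ ξ : A, ⟪B.v ξ, f⟫_ℂ = c ξ := fun ξ => by
    simp [hf, B.inner_v_u]
  have hfpos : 0 < ‖f‖ := by
    rw [norm_pos_iff]
    intro h0
    exact hc (funext fun ξ => by rw [← hcoef, h0, inner_zero_right, Pi.zero_apply])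
  have hup : ‖T f‖ ≤ t / (2 * C) * ‖f‖ := by
    refine norm_map_le_of_orthogonal hcomp (by positivity) fun s hs w hw => ?_
    have hs0 : 0 < s := lt_of_lt_of_le (by positivity) hs
    exact hspan ⟨s, hs0⟩ f (fun k => hcS _ (hS _ ((div_le_iff₀' (by positivity)).1 hs))) w hw
  have hlow : ‖f‖ ≤ C * t⁻¹ * ‖T f‖ := by
    have h1 := hB A (fun ξ => (σ ξ)⁻¹) t⁻¹ (by positivity) fun ξ hξ => by
      rw [norm_inv]
      exact inv_anti₀ ht (hA ξ hξ)
    have h2 := ContinuousLinearMap.le_of_opNorm_le _ h1 (T f)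
    suffices h4 : f = (∑ ξ ∈ A, (σ ξ)⁻¹ • B.coordProj ξ) (T f) by rwa [← h4] at h2
    rw [← Finset.sum_coe_sort A, sum_apply]
    conv_lhs => rw [hf]
    refine Finset.sum_congr rfl fun ξ _ => ?_
    have h0 : σ ξ ≠ 0 := norm_pos_iff.1 (ht.trans_le (hA ξ ξ.2))
    have h3 : ⟪B.v ξ, T f⟫_ℂ = σ ξ * c ξ := by
      simp [hf, hTu, B.inner_v_u, mul_comm]
    rw [smul_apply, coordProj_apply, h3, smul_smul, inv_mul_cancel_left₀ h0]
  have : C * t⁻¹ * ‖T f‖ ≤ C * t⁻¹ * (t / (2 * C) * ‖f‖) := by gcongr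
  have h4 : C * t⁻¹ * (t / (2 * C) * ‖f‖) = ‖f‖ / 2 := by field_simp
  linarith

lemma u_mem_smoothDomain (ξ : I) : B.u ξ ∈ smoothDomain L := by
  refine (Submodule.mem_iInf _).2 fun k => ?_
  induction k with
  | zero => exact Submodule.mem_top
  | succ k ih => exact mem_powDomain_succ.2 ⟨B.u_mem ξ, B.L_u ξ ▸ Submodule.smul_mem _ _ ih⟩

/-- The eigenfunction `u ξ` as a test function. -/
def testU (ξ : I) : TestSpace L := ⟨B.u ξ, B.u_mem_smoothDomain ξ⟩

@[simp] lemma incl_testU (ξ : I) : TestSpace.incl L (B.testU ξ) = B.u ξ := rfl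

/-- A Fourier multiplier belongs to `S_r` if and only if its symbol is `r`-summable. -/
theorem testMemSchatten_iff {A : TestSpace L →L[ℂ] TestSpace L} {σ : I → ℂ}
    (hA : ∀ f ξ, ⟪B.v ξ, TestSpace.incl L (A f)⟫_ℂ = σ ξ * ⟪B.v ξ, TestSpace.incl L f⟫_ℂ)
    {r : ℝ} (hr : 0 < r) : TestMemSchatten r A ↔ Summable fun ξ => ‖σ ξ‖ ^ r := by
  classical
  have hexp : ∀ f, HasSum (fun ξ => (σ ξ * ⟪B.v ξ, TestSpace.incl L f⟫_ℂ) • B.u ξ)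
      (TestSpace.incl L (A f)) := fun f => by
    simpa only [hA] using B.hasSum_expansion (TestSpace.incl L (A f))
  constructor
  · rintro ⟨T, hTA, hT⟩
    -- Since `u ξ` is a test function, the symbol fixes any bounded extension of `A` on it.
    refine B.summable_of_memSchatten hr hT fun ξ => ?_
    rw [← B.incl_testU ξ, hTA]
    refine (hexp _).unique ?_
    convert hasSum_single ξ fun η hη => ?_ using 1
    · simp [B.biorth_self]
    · simp [B.biorth_ne ξ η hη.symm]
  · intro hσ
    obtain ⟨T, hT⟩ := B.summable_smul_coordProj hr hσ
    refine ⟨T, fun f => ?_, B.memSchatten_of_hasSum hr hσ hT⟩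
    refine HasSum.unique ?_ (hexp f)
    have := hT.mapL (ContinuousLinearMap.apply ℂ H (TestSpace.incl L f))
    simpa [mul_smul] using this

end BiorthogonalEigensystem

end Multiplier

end NonharmonicAnalysis

theorem corollary3p7
    {M : Type*} [TopologicalSpace M] [CompactSpace M] [T2Space M]
    [MeasurableSpace M] [BorelSpace M] (μ : Measure M) [IsFiniteMeasure μ]
    {I : Type*} [Countable I]
    (L : Lp ℂ 2 μ →ₗ.[ℂ] Lp ℂ 2 μ)
    (B : NonharmonicAnalysis.BiorthogonalEigensystem L I)
    (A : NonharmonicAnalysis.TestSpace L →L[ℂ] NonharmonicAnalysis.TestSpace L)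
    (σ : I → ℂ) (hA : NonharmonicAnalysis.IsFourierMultiplier B A σ) :
    (∀ r : ℝ, 0 < r → r ≤ 1 → Summable (fun ξ => ‖σ ξ‖ ^ r) →
      NonharmonicAnalysis.TestMemSchatten r A) ∧
    (IsSelfAdjoint L → ∀ r : ℝ, 0 < r →
      (NonharmonicAnalysis.TestMemSchatten r A ↔ Summable (fun ξ => ‖σ ξ‖ ^ r))) := by
  have hA' : ∀ f ξ, ⟪B.v ξ, NonharmonicAnalysis.TestSpace.incl L (A f)⟫_ℂ =
      σ ξ * ⟪B.v ξ, NonharmonicAnalysis.TestSpace.incl L f⟫_ℂ := fun f ξ => by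
    simpa only [NonharmonicAnalysis.fourierL_eq_inner] using hA f ξ
  exact ⟨fun r hr _ => (B.testMemSchatten_iff hA' hr).2,
    fun _ r hr => B.testMemSchatten_iff hA' hr⟩
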